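/- Let $A\in\mathbb R^{m\times n}$, $b\in\mathbb R^m$, $c\in\mathbb R^n$, $B\in\mathbb R^{r\times n}$ with $r\ge 1$, and suppose that $\mathcal K=\{x\in\mathbb R^n: Ax=b,\ x\ge 0\}$ is nonempty and bounded. Let $\mathcal V$ be the set of vertices of $\mathcal K$, and for $u\in\mathbb R^r$ put $$g_0(u)=\tfrac12\|u\|^2+\min_{x\in\mathcal K}(c-B^{\intercal}u)^{\intercal}x .$$ For $v\in\mathcal V$ let $\mathcal C_v=\{u\in\mathbb R^r:(c-B^{\intercal}u)^{\intercal}v\le (c-B^{\intercal}u)^{\intercal}v'\text{ for all }v'\in\mathcal V\}$, and set $$\zeta_v(u)=\tfrac12\operatorname{dist}(u,\operatorname{bd}\mathcal C_v),\qquad \lambda(u)=\operatorname{dist}\Big(u,\bigcup_{v\in\mathcal V,\ u\notin\mathcal C_v}\mathcal C_v\Big),$$ with $\operatorname{dist}(u,\emptyset)=\infty$ and $\log_2(\eta_0/\infty)=-\infty$. Let $S=\{u: 0\in\partial g_0(u)\}$ be the set of Clarke critical points of $g_0$, where $\partial g_0(u)$ is the set of all $\xi\in\mathbb R^r$ with $\limsup_{y\to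 u,\,t\downarrow 0}\frac{g_0(y+tz)-g_0(y)}{t}\ge \xi^{\intercal}z$ for all $z\in\mathbb R^r$. Certification algorithm. Input: $u_\varepsilon\in\mathbb R^r$ and $\eta_0>0$; all comparisons are made in exact real arithmetic. (a) Pick any $\bar x\in\arg\min_{x\in\mathcal K}(c-B^{\intercal}u_\varepsilon)^{\intercal}x$ and set $\bar u=B\bar x$. If $(c-B^{\intercal}\bar u)^{\intercal}\bar x>\min_{x\in\mathcal K}(c-B^{\intercal}\bar u)^{\intercal}x$, return "$\bar u$ is not a local minimizer". (b) Sample $w$ uniformly from the unit sphere of $\mathbb R^r$; set $\eta=\eta_0$, $u_\pm=\bar u\pm\eta w$ and $s=\frac12\|\bar u\|^2+\min_{x\in\mathcal K}(c-B^{\intercal}\bar u)^{\intercal}x$. (c) Repeat (while loop): pick any $x_\pm\in\arg\min_{x\in\mathcal K}(c-B^{\intercal}u_\pm)^{\intercal}x$. If $Bx_+=Bx_-$, return "$\bar u$ is a local minimizer". Otherwise let $s_\pm=\frac12\|\bar u\|^2-(B^{\intercal}\bar u-c)^{\intercal}x_\pm$; if $s_+=s_-=s$, return "$\bar u$ is not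 a local minimizer"; otherwise replace $\eta$ by $\eta/2$ and $u_\pm$ by $\bar u\pm\eta w$. Then, for every $u_\varepsilon\in\mathbb R^r$, every $\eta_0>0$ and every choice of $\bar x$, with probability $1$ over $w$ the algorithm terminates and correctly decides whether $\bar u$ is a local minimizer of $g_0$, whichever solutions $x_\pm$ are picked in the loop. Moreover, for every unit vector $w$ and whichever solutions are picked: 1. if $\bar u\in\operatorname{int}(\mathcal C_v)$ with $v\in\mathcal V$, the while loop terminates within $\max\{0,\lceil\log_2(\eta_0/\zeta_v(\bar u))\rceil\}+1$ iterations; 2. if $\bar u\in\operatorname{bd}(\mathcal C_v)$ with $v\in\mathcal V$, the while loop terminates within $\max\{0,\lceil\log_2(\eta_0/\lambda(\bar u))\rceil\}+2$ iterations. Furthermore, $S$ is finite, and for every input $u_\varepsilon$ the algorithm terminates after at most $$\max_{v\in\mathcal V}\left\{\max\Big\{0,\max_{u\in S\cap\operatorname{int}(\mathcal C_v)}\lceil\log_2(\eta_0/\zeta_v(u))\rceil\Big\}+1,\ \max\Big\{0,\max_{u\in S\cap\operatorname{bd}(\mathcal C_v)}\lceil\log_2(\eta_0/\lambda(u))\rceil\Big\}+2\right\}<\infty$$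 iterations of the while loop, a maximum over the empty set being $-\infty$. -/

import Mathlib

open MeasureTheory Filter Topology
open scoped ENNReal

/-- Data of a concave quadratic program
`minimize -(1/2) xᵀ (Bᵀ B) x + cᵀ x` subject to `A x = b`, `x ≥ 0`, with `x ∈ ℝⁿ` and `B` of
size `r × n`. -/
structure ConcaveQP (m n r : ℕ) where
  A : Matrix (Fin m) (Fin n) ℝ
  b : Fin m → ℝ
  c : Fin n → ℝ
  B : Matrix (Fin r) (Fin n) ℝ

namespace ConcaveQP

variable {m n r : ℕ} (P : ConcaveQP m n r)

/-- The feasible set `K = {x : A x = b, x ≥ 0}`. -/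
def feasible : Set (Fin n → ℝ) := {x | P.A.mulVec x = P.b ∧ 0 ≤ x}

/-- The vertices of `K`. -/
def vertices : Set (Fin n → ℝ) := P.feasible.extremePoints ℝ

/-- The point `B x` of Euclidean space `ℝʳ`. -/
def image (x : Fin n → ℝ) : EuclideanSpace ℝ (Fin r) := WithLp.toLp 2 (P.B.mulVec x)

/-- The linear cost `(c - Bᵀ u)ᵀ x`. -/
def cost (u : EuclideanSpace ℝ (Fin r)) (x : Fin n → ℝ) : ℝ :=
  (P.c - P.B.transpose.mulVec u.ofLp) ⬝ᵥ x

/-- The optimal value `min_{x ∈ K} (c - Bᵀ u)ᵀ x` (attained when `K` is nonempty and bounded). -/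
noncomputable def lpValue (u : EuclideanSpace ℝ (Fin r)) : ℝ := sInf (P.cost u '' P.feasible)

/-- The solution set `argmin_{x ∈ K} (c - Bᵀ u)ᵀ x`. -/
def lpArgmin (u : EuclideanSpace ℝ (Fin r)) : Set (Fin n → ℝ) :=
  {x | x ∈ P.feasible ∧ ∀ y ∈ P.feasible, P.cost u x ≤ P.cost u y}

/-- The unregularized variational objective
`g₀(u) = (1/2) ‖u‖² + min_{x ∈ K} (c - Bᵀ u)ᵀ x`. -/
noncomputable def g0 (u : EuclideanSpace ℝ (Fin r)) : ℝ := 1 / 2 * ‖u‖ ^ 2 + P.lpValue u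

/-- The region of all `u` for which the vertex `v` is optimal among the vertices. -/
def region (v : Fin n → ℝ) : Set (EuclideanSpace ℝ (Fin r)) :=
  {u | ∀ v' ∈ P.vertices, P.cost u v ≤ P.cost u v'}

/-- `ζ(u) = (1/2) dist(u, bd C_v)`, with `dist(u, ∅) = ∞`. -/
noncomputable def zeta (v : Fin n → ℝ) (u : EuclideanSpace ℝ (Fin r)) : ℝ≥0∞ :=
  Metric.infEDist u (frontier (P.region v)) / 2

/-- `λ(u)`: the distance from `u` to the union of the regions which do not contain `u`, with
`dist(u, ∅) = ∞`. -/
noncomputable def lam (u : EuclideanSpace ℝ (Fin r)) : ℝ≥0∞ :=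
  Metric.infEDist u (⋃ v ∈ {v | v ∈ P.vertices ∧ u ∉ P.region v}, P.region v)

end ConcaveQP

/-- The Clarke subdifferential: all `ξ` such that, for every direction `v`,
`⟪ξ, v⟫ ≤ limsup_{y → x, t ↓ 0} (f (y + t v) - f y) / t`. -/
def clarkeSubdifferential {r : ℕ} (f : EuclideanSpace ℝ (Fin r) → ℝ)
    (x : EuclideanSpace ℝ (Fin r)) : Set (EuclideanSpace ℝ (Fin r)) :=
  {ξ | ∀ v : EuclideanSpace ℝ (Fin r),
    ((inner ℝ ξ v : ℝ) : EReal) ≤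
      limsup (fun p : EuclideanSpace ℝ (Fin r) × ℝ =>
        (((f (p.1 + p.2 • v) - f p.1) / p.2 : ℝ) : EReal)) (𝓝 x ×ˢ 𝓝[>] (0 : ℝ))}

/-- The Clarke critical points of `f`. -/
def clarkeCriticalPoints {r : ℕ} (f : EuclideanSpace ℝ (Fin r) → ℝ) :
    Set (EuclideanSpace ℝ (Fin r)) :=
  {x | 0 ∈ clarkeSubdifferential f x}

/-- The uniform distribution on the unit sphere of `ℝʳ`: normalized surface measure. -/
noncomputable def uniformSphere (r : ℕ) :
    Measure (Metric.sphere (0 : EuclideanSpace ℝ (Fin r)) 1) :=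
  ((volume : Measure (EuclideanSpace ℝ (Fin r))).toSphere Set.univ)⁻¹ •
    (volume : Measure (EuclideanSpace ℝ (Fin r))).toSphere

theorem isProbabilityMeasure_uniformSphere {r : ℕ} (hr : 0 < r) :
    IsProbabilityMeasure (uniformSphere r) := by
  have : Nonempty (Fin r) := ⟨⟨0, hr⟩⟩
  have : Nontrivial (EuclideanSpace ℝ (Fin r)) := inferInstance
  refine ⟨?_⟩
  rw [uniformSphere, Measure.smul_apply, smul_eq_mul]
  refine ENNReal.inv_mul_cancel ?_ (measure_ne_top _ _)
  rw [Measure.toSphere_apply_univ]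
  refine mul_ne_zero ?_ ?_
  · simpa using hr.ne'
  · exact (Metric.measure_ball_pos _ _ one_pos).ne'

/-- `max {0, ⌈log₂ (η₀ / d)⌉}` for `η₀ > 0` and `0 ≤ d ≤ ∞`, with `log₂ (η₀ / ∞) = -∞` and
`log₂ (η₀ / 0) = ∞`; the ceiling `⌈·⌉₊` is truncated below at `0`. -/
noncomputable def numHalvings (η₀ : ℝ) (d : ℝ≥0∞) : ℕ∞ :=
  if d = 0 then ⊤ else if d = ⊤ then 0 else ((⌈Real.logb 2 (η₀ / d.toReal)⌉₊ : ℕ) : ℕ∞)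

/-- The two possible answers of the certification algorithm. -/
inductive Verdict
  | localMinimizer
  | notLocalMinimizer

namespace ConcaveQP

variable {m n r : ℕ} (P : ConcaveQP m n r)

/-- The uniform bound on the number of loop iterations: the maximum over the vertices `v` of
`max {0, max_{u ∈ S ∩ int C_v} ⌈log₂ (η₀ / ζ(u))⌉} + 1` and
`max {0, max_{u ∈ S ∩ bd C_v} ⌈log₂ (η₀ / λ(u))⌉} + 2`, where `S` is the set of Clarke critical
points of `g₀`. -/
noncomputable def uniformBound (η₀ : ℝ) : ℕ∞ :=
  ⨆ v ∈ P.vertices,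
    max ((⨆ u ∈ clarkeCriticalPoints P.g0 ∩ interior (P.region v), numHalvings η₀ (P.zeta v u)) + 1)
      ((⨆ u ∈ clarkeCriticalPoints P.g0 ∩ frontier (P.region v), numHalvings η₀ (P.lam u)) + 2)

/-- `pick k u` is a solution of the linear program with cost `c - Bᵀ u`, for each `u` and each
iteration `k`. The solution is arbitrary and may change from one iteration to another. -/
def IsPicker (pick : ℕ → EuclideanSpace ℝ (Fin r) → (Fin n → ℝ)) : Prop :=
  ∀ k u, pick k u ∈ P.lpArgmin u

/-- The variables of the while loop; `result` is `none` as long as nothing has been returned. -/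
structure LoopState (r : ℕ) where
  eta : ℝ
  uPlus : EuclideanSpace ℝ (Fin r)
  uMinus : EuclideanSpace ℝ (Fin r)
  result : Option Verdict

open Classical in
/-- The body of the while loop, with `xPlus` and `xMinus` the picked solutions of the linear
programs at `uPlus` and `uMinus`. -/
noncomputable def loopBody (ubar w : EuclideanSpace ℝ (Fin r)) (xPlus xMinus : Fin n → ℝ)
    (st : LoopState r) : LoopState r :=
  let s : ℝ := 1 / 2 * ‖ubar‖ ^ 2 + P.lpValue ubar
  let sPlus : ℝ := 1 / 2 * ‖ubar‖ ^ 2 - (P.B.transpose.mulVec ubar.ofLp - P.c) ⬝ᵥ xPlus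
  let sMinus : ℝ := 1 / 2 * ‖ubar‖ ^ 2 - (P.B.transpose.mulVec ubar.ofLp - P.c) ⬝ᵥ xMinus
  if P.image xPlus = P.image xMinus then
    { st with result := some Verdict.localMinimizer }
  else if sPlus = s ∧ sMinus = s then
    { st with result := some Verdict.notLocalMinimizer }
  else
    { eta := st.eta / 2
      uPlus := ubar + (st.eta / 2) • w
      uMinus := ubar - (st.eta / 2) • w
      result := none }

/-- The state of the while loop after at most `k` iterations; once something has been returned
the state does not change any more. -/
noncomputable def loopState (η₀ : ℝ) (ubar w : EuclideanSpace ℝ (Fin r))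
    (pickPlus pickMinus : ℕ → EuclideanSpace ℝ (Fin r) → (Fin n → ℝ)) : ℕ → LoopState r
  | 0 => { eta := η₀, uPlus := ubar + η₀ • w, uMinus := ubar - η₀ • w, result := none }
  | k + 1 =>
    let st := loopState η₀ ubar w pickPlus pickMinus k
    match st.result with
    | some _ => st
    | none => P.loopBody ubar w (pickPlus k st.uPlus) (pickMinus k st.uMinus) st

open Classical in
/-- The certification algorithm for the candidate `ubar = B xbar`, the initial step size `η₀`
and the sampled direction `w`, run for at most `k` iterations of the while loop: the answer if one
has been returned by then, and `none` otherwise. -/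
noncomputable def certify (η₀ : ℝ) (xbar : Fin n → ℝ) (w : EuclideanSpace ℝ (Fin r))
    (pickPlus pickMinus : ℕ → EuclideanSpace ℝ (Fin r) → (Fin n → ℝ)) (k : ℕ) : Option Verdict :=
  if P.cost (P.image xbar) xbar > P.lpValue (P.image xbar) then
    some Verdict.notLocalMinimizer
  else
    (P.loopState η₀ (P.image xbar) w pickPlus pickMinus k).result

end ConcaveQP

/-- The run eventually returns the answer `a`. -/
def Returns (run : ℕ → Option Verdict) (a : Verdict) : Prop := ∃ k, run k = some a

/-- The run returns an answer within `N` iterations. -/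
def TerminatesWithin (run : ℕ → Option Verdict) (N : ℕ∞) : Prop :=
  ∃ k : ℕ, (k : ℕ∞) ≤ N ∧ ∃ a, run k = some a

/-! The cost at `u` is `c·x - ⟪u, Bx⟫`, so `F(u) = B(argmin at u)` is a monotone set-valued map.
Each argmin is an exposed face of the polytope `K`, the convex hull of the vertices whose regions
contain `u`. Since there are finitely many closed regions, `argmin y ⊆ argmin u` for all `y` within
`λ(u)` of `u`.

Freezing a feasible `x` gives a quadratic majorant of `g₀` with minimizer `Bx`. Hence `u` is a local
minimizer iff `F(u) = {u}` (`isLocalMin_g0_iff`), and it is Clarke critical iff `u ∈ F(u)`. By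
monotonicity a critical point is determined by its set of active vertices, so `S` is finite.

Correctness: a negative verdict in the loop exhibits two points of `F(ubar)`. A positive one, `Bx₊ =
Bx₋`, forces `w` to be orthogonal to all differences in `F(ubar)` (`inner_image_sub_eq_zero`).
Outside finitely many great subspheres, a null set, this makes `F(ubar)` a singleton, which is
`{ubar}` because step (a) has been passed. Termination: at a step below `λ(ubar)` both picks solve
the program at `ubar`; inside a region `C_v`, `F` is constantly `{Bv}`. -/

namespace ConcaveQP

/-! ### Polyhedral geometry: faces, vertices and regions -/

variable {m n r : ℕ} (P : ConcaveQP m n r)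

/-- The linear map `x ↦ B x` into Euclidean space. -/
noncomputable def imageLinear : (Fin n → ℝ) →ₗ[ℝ] EuclideanSpace ℝ (Fin r) :=
  (WithLp.linearEquiv 2 ℝ (Fin r → ℝ)).symm.toLinearMap ∘ₗ P.B.mulVecLin

/-- The cost `x ↦ (c - Bᵀ u)ᵀ x` as a linear map. -/
noncomputable def costLinear (u : EuclideanSpace ℝ (Fin r)) : (Fin n → ℝ) →ₗ[ℝ] ℝ :=
  dotProductBilin ℝ ℝ (P.c - P.B.transpose.mulVec u.ofLp)

theorem costLinear_apply (u : EuclideanSpace ℝ (Fin r)) (x : Fin n → ℝ) :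
    P.costLinear u x = P.cost u x := rfl

theorem cost_eq (u : EuclideanSpace ℝ (Fin r)) (x : Fin n → ℝ) :
    P.cost u x = P.c ⬝ᵥ x - inner ℝ u (P.image x) := by
  rw [cost, sub_dotProduct, image, EuclideanSpace.inner_eq_star_dotProduct]
  congr 1
  rw [Matrix.mulVec_transpose, ← Matrix.dotProduct_mulVec, dotProduct_comm]
  simp

theorem convex_feasible : Convex ℝ P.feasible := by
  have h : P.feasible = P.A.mulVecLin ⁻¹' {P.b} ∩ Set.Ici 0 := by
    ext x; simp [feasible]
  rw [h]
  exact ((convex_singleton _).linear_preimage _).inter (convex_Ici _)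

theorem isClosed_feasible : IsClosed P.feasible := by
  have h : P.feasible = P.A.mulVecLin ⁻¹' {P.b} ∩ Set.Ici 0 := by
    ext x; simp [feasible]
  rw [h]
  exact (isClosed_singleton.preimage (LinearMap.continuous_of_finiteDimensional _)).inter
    isClosed_Ici

theorem isCompact_feasible (hbdd : Bornology.IsBounded P.feasible) : IsCompact P.feasible :=
  Metric.isCompact_of_isClosed_isBounded P.isClosed_feasible hbdd

theorem continuous_cost (u : EuclideanSpace ℝ (Fin r)) : Continuous (P.cost u) :=
  LinearMap.continuous_of_finiteDimensional (P.costLinear u)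

theorem continuous_cost_left (x : Fin n → ℝ) : Continuous fun u => P.cost u x := by
  simp only [cost_eq]
  fun_prop

theorem isExposed_lpArgmin (u : EuclideanSpace ℝ (Fin r)) :
    IsExposed ℝ P.feasible (P.lpArgmin u) := by
  intro _
  refine ⟨-LinearMap.toContinuousLinearMap (P.costLinear u), ?_⟩
  ext x
  simp [lpArgmin, costLinear_apply]

theorem convex_lpArgmin (u : EuclideanSpace ℝ (Fin r)) : Convex ℝ (P.lpArgmin u) :=
  (P.isExposed_lpArgmin u).convex P.convex_feasible

theorem isCompact_lpArgmin (hbdd : Bornology.IsBounded P.feasible)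
    (u : EuclideanSpace ℝ (Fin r)) : IsCompact (P.lpArgmin u) :=
  (P.isExposed_lpArgmin u).isCompact (P.isCompact_feasible hbdd)

theorem nonempty_lpArgmin (hne : P.feasible.Nonempty) (hbdd : Bornology.IsBounded P.feasible)
    (u : EuclideanSpace ℝ (Fin r)) : (P.lpArgmin u).Nonempty := by
  obtain ⟨x, hx, h⟩ := (P.isCompact_feasible hbdd).exists_isMinOn hne
    (P.continuous_cost u).continuousOn
  exact ⟨x, hx, fun y hy => h hy⟩

/-- A vertex is determined by its zero set: if `y` vanishes wherever `x` does, then `x` can be moved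
slightly away from `y` inside `K`, which puts `x` in an open segment starting at `y`. -/
theorem finite_vertices : P.vertices.Finite := by
  refine Set.Finite.of_injOn (f := fun x => {i | x i = 0}) (t := Set.univ)
    (Set.mapsTo_univ _ _) ?_ Set.finite_univ
  intro x hx y hy hxy
  have hzero : ∀ i, x i = 0 → y i = 0 := fun i hi => (Set.ext_iff.1 hxy i).1 hi
  have hxf : P.feasible x := hx.1
  have hyf : P.feasible y := hy.1
  obtain ⟨hxA, hx0⟩ := hxf
  obtain ⟨hyA, hy0⟩ := hyf
  have hev : ∀ᶠ t : ℝ in 𝓝[>] 0, ∀ i, 0 ≤ x i - t * (y i - x i) := by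
    rw [eventually_all]
    intro i
    rcases (hx0 i).eq_or_lt with h | h
    · have h' : x i = 0 := h.symm
      simp [h', hzero i h']
    · have hc : Tendsto (fun t : ℝ => x i - t * (y i - x i)) (𝓝[>] 0) (𝓝 (x i)) := by
        have : Continuous fun t : ℝ => x i - t * (y i - x i) := by fun_prop
        simpa using (this.tendsto 0).mono_left nhdsWithin_le_nhds
      exact (hc.eventually_const_lt h).mono fun t ht => ht.le
  obtain ⟨t, ht, ht0⟩ := (hev.and self_mem_nhdsWithin).exists
  replace ht0 : 0 < t := ht0
  have hz : x - t • (y - x) ∈ P.feasible := by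
    refine ⟨?_, fun i => by simpa using ht i⟩
    rw [Matrix.mulVec_sub, Matrix.mulVec_smul, Matrix.mulVec_sub, hxA, hyA]
    simp
  have hseg : x ∈ openSegment ℝ y (x - t • (y - x)) := by
    refine ⟨t / (1 + t), 1 / (1 + t), by positivity, by positivity, by field_simp; ring, ?_⟩
    ext i
    simp only [Pi.add_apply, Pi.smul_apply, Pi.sub_apply, smul_eq_mul]
    field_simp
    ring
  exact (hx.2 hy.1 hz hseg).symm

/-- Krein–Milman for the face; its extreme points are vertices of `K`, hence finitely many, so no
closure is needed. -/
theorem lpArgmin_subset_convexHull (hbdd : Bornology.IsBounded P.feasible)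
    (u : EuclideanSpace ℝ (Fin r)) :
    P.lpArgmin u ⊆ convexHull ℝ (P.vertices ∩ P.lpArgmin u) := by
  have hsub : (P.lpArgmin u).extremePoints ℝ ⊆ P.vertices ∩ P.lpArgmin u := fun x hx =>
    ⟨(P.isExposed_lpArgmin u).isExtreme.extremePoints_subset_extremePoints hx, hx.1⟩
  have hfin := (P.finite_vertices.inter_of_left (P.lpArgmin u)).subset hsub
  have h := closure_convexHull_extremePoints (P.isCompact_lpArgmin hbdd u) (P.convex_lpArgmin u)
  rw [(Set.Finite.isClosed_convexHull ℝ hfin).closure_eq] at h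
  exact h.symm.subset.trans (convexHull_mono hsub)

theorem exists_vertex_mem_lpArgmin (hne : P.feasible.Nonempty)
    (hbdd : Bornology.IsBounded P.feasible) (u : EuclideanSpace ℝ (Fin r)) :
    ∃ v ∈ P.vertices, v ∈ P.lpArgmin u := by
  have h := (P.nonempty_lpArgmin hne hbdd u).mono (P.lpArgmin_subset_convexHull hbdd u)
  exact convexHull_nonempty_iff.1 h

theorem lpValue_eq {u : EuclideanSpace ℝ (Fin r)} {x : Fin n → ℝ} (hx : x ∈ P.lpArgmin u) :
    P.lpValue u = P.cost u x :=
  IsLeast.csInf_eq ⟨Set.mem_image_of_mem _ hx.1, Set.forall_mem_image.2 hx.2⟩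

theorem lpValue_le {u : EuclideanSpace ℝ (Fin r)} {x : Fin n → ℝ}
    (hne : P.feasible.Nonempty) (hbdd : Bornology.IsBounded P.feasible)
    (hx : x ∈ P.feasible) : P.lpValue u ≤ P.cost u x := by
  obtain ⟨y, hy⟩ := P.nonempty_lpArgmin hne hbdd u
  exact (P.lpValue_eq hy).trans_le (hy.2 x hx)

theorem mem_lpArgmin_iff {u : EuclideanSpace ℝ (Fin r)} {x : Fin n → ℝ}
    (hne : P.feasible.Nonempty) (hbdd : Bornology.IsBounded P.feasible) (hx : x ∈ P.feasible) :
    x ∈ P.lpArgmin u ↔ P.cost u x = P.lpValue u :=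
  ⟨fun h => (P.lpValue_eq h).symm, fun h => ⟨hx, fun _ hy => h ▸ P.lpValue_le hne hbdd hy⟩⟩

theorem mem_region_iff (hne : P.feasible.Nonempty) (hbdd : Bornology.IsBounded P.feasible)
    {u : EuclideanSpace ℝ (Fin r)} {v : Fin n → ℝ} (hv : v ∈ P.vertices) :
    u ∈ P.region v ↔ v ∈ P.lpArgmin u := by
  refine ⟨fun h => ?_, fun h v' hv' => h.2 v' hv'.1⟩
  obtain ⟨v', hv', h'⟩ := P.exists_vertex_mem_lpArgmin hne hbdd u
  exact ⟨hv.1, fun y hy => (h v' hv').trans (h'.2 y hy)⟩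

theorem isClosed_region (v : Fin n → ℝ) : IsClosed (P.region v) := by
  simp only [region, Set.ofPred_forall]
  exact isClosed_biInter fun v' _ =>
    isClosed_le (P.continuous_cost_left v) (P.continuous_cost_left v')

theorem lpArgmin_subset_of_region (hne : P.feasible.Nonempty)
    (hbdd : Bornology.IsBounded P.feasible) {y u : EuclideanSpace ℝ (Fin r)}
    (h : ∀ v ∈ P.vertices, y ∈ P.region v → u ∈ P.region v) :
    P.lpArgmin y ⊆ P.lpArgmin u := by
  refine (P.lpArgmin_subset_convexHull hbdd y).trans (convexHull_min ?_ (P.convex_lpArgmin u))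
  exact fun v hv => (P.mem_region_iff hne hbdd hv.1).1
    (h v hv.1 ((P.mem_region_iff hne hbdd hv.1).2 hv.2))

theorem isClosed_iUnion_region (u : EuclideanSpace ℝ (Fin r)) :
    IsClosed (⋃ v ∈ {v | v ∈ P.vertices ∧ u ∉ P.region v}, P.region v) :=
  (P.finite_vertices.subset fun _ h => h.1).isClosed_biUnion fun v _ => P.isClosed_region v

/-- A finite union of closed regions is closed, and this one misses `u`. -/
theorem lam_ne_zero (u : EuclideanSpace ℝ (Fin r)) : P.lam u ≠ 0 := by
  rw [lam, Ne, ← Metric.mem_closure_iff_infEDist_zero, (P.isClosed_iUnion_region u).closure_eq]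
  simp only [Set.mem_iUnion, not_exists]
  exact fun v hv => hv.2

theorem zeta_ne_zero {v : Fin n → ℝ} {u : EuclideanSpace ℝ (Fin r)}
    (hu : u ∈ interior (P.region v)) : P.zeta v u ≠ 0 := by
  rw [zeta, Ne, ENNReal.div_eq_zero_iff, not_or, ← Metric.mem_closure_iff_infEDist_zero,
    isClosed_frontier.closure_eq]
  exact ⟨fun h => h.2 hu, by simp⟩

theorem lpArgmin_subset_of_edist_lt (hne : P.feasible.Nonempty)
    (hbdd : Bornology.IsBounded P.feasible) {y u : EuclideanSpace ℝ (Fin r)}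
    (h : edist u y < P.lam u) : P.lpArgmin y ⊆ P.lpArgmin u := by
  refine P.lpArgmin_subset_of_region hne hbdd fun v hv hy => by_contra fun hu => ?_
  have hmem : y ∈ ⋃ v ∈ {v | v ∈ P.vertices ∧ u ∉ P.region v}, P.region v :=
    Set.mem_iUnion₂.2 ⟨v, ⟨hv, hu⟩, hy⟩
  exact (Metric.infEDist_le_edist_of_mem hmem).not_gt h

theorem eventually_lpArgmin_subset (hne : P.feasible.Nonempty)
    (hbdd : Bornology.IsBounded P.feasible) (u : EuclideanSpace ℝ (Fin r)) :
    ∀ᶠ y in 𝓝 u, P.lpArgmin y ⊆ P.lpArgmin u := by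
  filter_upwards [Metric.eball_mem_nhds u (pos_iff_ne_zero.2 (P.lam_ne_zero u))] with y hy
  exact P.lpArgmin_subset_of_edist_lt hne hbdd (by rwa [edist_comm])

/-! ### Monotonicity and local minimizers -/

/-- Adding the two optimality inequalities cancels `c`. -/
theorem inner_image_le_of_mem_lpArgmin {u y : EuclideanSpace ℝ (Fin r)} {x x' : Fin n → ℝ}
    (hx : x ∈ P.lpArgmin u) (hx' : x' ∈ P.lpArgmin y) :
    0 ≤ inner ℝ (y - u) (P.image x' - P.image x) := by
  have h1 := hx.2 x' hx'.1
  have h2 := hx'.2 x hx.1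
  simp only [cost_eq] at h1 h2
  simp only [inner_sub_left, inner_sub_right]
  linarith

theorem g0_le {u : EuclideanSpace ℝ (Fin r)} {x : Fin n → ℝ}
    (hne : P.feasible.Nonempty) (hbdd : Bornology.IsBounded P.feasible) (hx : x ∈ P.feasible) :
    P.g0 u ≤ 1 / 2 * ‖u‖ ^ 2 + (P.c ⬝ᵥ x - inner ℝ u (P.image x)) := by
  rw [g0, ← cost_eq]
  gcongr
  exact P.lpValue_le hne hbdd hx

theorem g0_eq {u : EuclideanSpace ℝ (Fin r)} {x : Fin n → ℝ} (hx : x ∈ P.lpArgmin u) :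
    P.g0 u = 1 / 2 * ‖u‖ ^ 2 + (P.c ⬝ᵥ x - inner ℝ u (P.image x)) := by
  rw [g0, ← cost_eq, P.lpValue_eq hx]

theorem isLocalMin_g0_iff (hne : P.feasible.Nonempty) (hbdd : Bornology.IsBounded P.feasible)
    (u : EuclideanSpace ℝ (Fin r)) :
    IsLocalMin P.g0 u ↔ ∀ x ∈ P.lpArgmin u, P.image x = u := by
  constructor
  · intro h x hx
    have hc : Tendsto (fun t : ℝ => u + t • (P.image x - u)) (𝓝[>] 0) (𝓝 u) := by
      have : Continuous fun t : ℝ => u + t • (P.image x - u) := by fun_prop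
      simpa using (this.tendsto 0).mono_left nhdsWithin_le_nhds
    have hlt : ∀ᶠ t : ℝ in 𝓝[>] 0, t < 1 :=
      nhdsWithin_le_nhds (eventually_lt_nhds one_pos)
    obtain ⟨t, ⟨ht, ht1⟩, ht0⟩ := (((hc.eventually h).and hlt).and self_mem_nhdsWithin).exists
    replace ht0 : 0 < t := ht0
    have h1 := ht.trans (P.g0_le hne hbdd hx.1)
    rw [P.g0_eq hx] at h1
    -- The majorant for `x` is `½‖· - Bx‖²` plus a constant and touches `g₀` at `u`; moving a
    -- fraction `t` towards `Bx` lowers it by `½ t (2 - t) ‖Bx - u‖²`.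
    have h2 : ‖P.image x - u‖ ^ 2 * (t * (2 - t)) ≤ 0 := by
      rw [← real_inner_self_eq_norm_sq] at h1 ⊢
      rw [← real_inner_self_eq_norm_sq] at h1
      simp only [inner_add_left, inner_add_right, inner_sub_left, inner_sub_right,
        real_inner_smul_left, real_inner_smul_right, real_inner_comm (P.image x) u] at h1 ⊢
      linarith
    have h3 : 0 < t * (2 - t) := mul_pos ht0 (by linarith)
    have h4 : ‖P.image x - u‖ ^ 2 = 0 :=
      le_antisymm (nonpos_of_mul_nonpos_left h2 h3) (sq_nonneg _)
    exact sub_eq_zero.1 (norm_eq_zero.1 (pow_eq_zero_iff two_ne_zero |>.1 h4))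
  · intro h
    -- Near `u` a solution at `y` also solves at `u`, so `g₀ y - g₀ u = ½‖y - u‖²`.
    filter_upwards [P.eventually_lpArgmin_subset hne hbdd u] with y hy
    obtain ⟨x, hx⟩ := P.nonempty_lpArgmin hne hbdd y
    rw [P.g0_eq hx, P.g0_eq (hy hx), h x (hy hx)]
    have h1 := norm_sub_sq_real y u
    have h2 := real_inner_self_eq_norm_sq u
    nlinarith [sq_nonneg ‖y - u‖]

/-! ### Clarke critical points -/

theorem g0_add_smul_sub_div_le (hne : P.feasible.Nonempty)
    (hbdd : Bornology.IsBounded P.feasible) {y z : EuclideanSpace ℝ (Fin r)} {t : ℝ} (ht : 0 < t)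
    {x : Fin n → ℝ} (hx : x ∈ P.lpArgmin y) :
    (P.g0 (y + t • z) - P.g0 y) / t ≤ inner ℝ (y - P.image x) z + t / 2 * ‖z‖ ^ 2 := by
  rw [div_le_iff₀ ht, P.g0_eq hx]
  have h := P.g0_le (u := y + t • z) hne hbdd hx.1
  have h1 := norm_add_sq_real y (t • z)
  rw [norm_smul, mul_pow, Real.norm_eq_abs, sq_abs, real_inner_smul_right] at h1
  rw [inner_add_left, real_inner_smul_left, real_inner_comm (P.image x) z] at h
  rw [inner_sub_left]
  linarith

theorem le_g0_add_smul_sub_div (hne : P.feasible.Nonempty)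
    (hbdd : Bornology.IsBounded P.feasible) {y z : EuclideanSpace ℝ (Fin r)} {t : ℝ} (ht : 0 < t)
    {x : Fin n → ℝ} (hx : x ∈ P.lpArgmin (y + t • z)) :
    inner ℝ (y - P.image x) z ≤ (P.g0 (y + t • z) - P.g0 y) / t := by
  rw [le_div_iff₀ ht, P.g0_eq hx]
  have h := P.g0_le (u := y) hne hbdd hx.1
  have h1 := norm_add_sq_real y (t • z)
  rw [norm_smul, mul_pow, Real.norm_eq_abs, sq_abs, real_inner_smul_right] at h1
  rw [inner_add_left, real_inner_smul_left, real_inner_comm (P.image x) z, inner_sub_left]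
  have h2 : 0 ≤ t ^ 2 * ‖z‖ ^ 2 := by positivity
  linarith

theorem isClosed_image_lpArgmin (hbdd : Bornology.IsBounded P.feasible)
    (u : EuclideanSpace ℝ (Fin r)) : IsClosed (P.image '' P.lpArgmin u) :=
  ((P.isCompact_lpArgmin hbdd u).image
    (LinearMap.continuous_of_finiteDimensional P.imageLinear)).isClosed

theorem convex_image_lpArgmin (u : EuclideanSpace ℝ (Fin r)) :
    Convex ℝ (P.image '' P.lpArgmin u) :=
  (P.convex_lpArgmin u).linear_image P.imageLinear

/-- Otherwise some `z` strictly separates `u` from the compact convex set `F(u)`, which contains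
`F(y)` for `y` near `u`; the difference quotients along `z` are then bounded above by a negative
constant. -/
theorem exists_image_eq_of_mem_clarkeCriticalPoints (hne : P.feasible.Nonempty)
    (hbdd : Bornology.IsBounded P.feasible) {u : EuclideanSpace ℝ (Fin r)}
    (hu : u ∈ clarkeCriticalPoints P.g0) : ∃ x ∈ P.lpArgmin u, P.image x = u := by
  by_contra hcon
  obtain ⟨f, a, hfa, haf⟩ := geometric_hahn_banach_point_closed (P.convex_image_lpArgmin u)
    (P.isClosed_image_lpArgmin hbdd u) (x := u) hcon
  obtain ⟨z, rfl⟩ := (InnerProductSpace.toDual ℝ (EuclideanSpace ℝ (Fin r))).surjective f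
  simp only [InnerProductSpace.toDual_apply_apply] at hfa haf
  have hcont : Tendsto (fun p : EuclideanSpace ℝ (Fin r) × ℝ =>
      inner ℝ z p.1 - a + p.2 / 2 * ‖z‖ ^ 2) (𝓝 u ×ˢ 𝓝[>] (0 : ℝ)) (𝓝 (inner ℝ z u - a)) := by
    have hc : Continuous fun p : EuclideanSpace ℝ (Fin r) × ℝ =>
      inner ℝ z p.1 - a + p.2 / 2 * ‖z‖ ^ 2 := by fun_prop
    have := hc.tendsto (u, 0)
    rw [nhds_prod_eq] at this
    simpa using this.mono_left (Filter.prod_mono le_rfl nhdsWithin_le_nhds)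
  have hlt : inner ℝ z u - a < (inner ℝ z u - a) / 2 := by linarith
  have hle : limsup (fun p : EuclideanSpace ℝ (Fin r) × ℝ =>
      (((P.g0 (p.1 + p.2 • z) - P.g0 p.1) / p.2 : ℝ) : EReal)) (𝓝 u ×ˢ 𝓝[>] (0 : ℝ)) ≤
      (((inner ℝ z u - a) / 2 : ℝ) : EReal) := by
    refine limsup_le_of_le (by isBoundedDefault) ?_
    filter_upwards [hcont.eventually_lt_const hlt,
      prod_mem_prod (P.eventually_lpArgmin_subset hne hbdd u) self_mem_nhdsWithin]
      with ⟨y, t⟩ h1 ⟨h2, h3⟩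
    obtain ⟨x, hx⟩ := P.nonempty_lpArgmin hne hbdd y
    have h4 := haf _ (Set.mem_image_of_mem _ (h2 hx))
    have h5 := P.g0_add_smul_sub_div_le hne hbdd (z := z) h3 hx
    rw [inner_sub_left, real_inner_comm, real_inner_comm z] at h5
    refine EReal.coe_le_coe_iff.2 ?_
    simp only at h1 h5 ⊢
    linarith
  have h0 := (hu z).trans hle
  rw [inner_zero_left, EReal.coe_le_coe_iff] at h0
  linarith

theorem mem_clarkeCriticalPoints_of_image_eq (hne : P.feasible.Nonempty)
    (hbdd : Bornology.IsBounded P.feasible) {u : EuclideanSpace ℝ (Fin r)} {x : Fin n → ℝ}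
    (hx : x ∈ P.lpArgmin u) (hxu : P.image x = u) : u ∈ clarkeCriticalPoints P.g0 := by
  intro z
  rw [inner_zero_left]
  -- With base point `u - 2tz` the endpoint is `u - tz`, where monotonicity gives `⟪z, Bx'⟫ ≤ ⟪z,
  -- u⟫`; the quotient is then at least `-2t‖z‖²`.
  have hfst : Tendsto (fun t : ℝ => u - (2 * t) • z) (𝓝[>] 0) (𝓝 u) := by
    have hc : Continuous fun t : ℝ => u - (2 * t) • z := by fun_prop
    simpa using (hc.tendsto 0).mono_left nhdsWithin_le_nhds
  have htend : Tendsto (fun t : ℝ => (u - (2 * t) • z, t)) (𝓝[>] 0) (𝓝 u ×ˢ 𝓝[>] (0 : ℝ)) :=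
    hfst.prodMk tendsto_id
  have hlow : Tendsto (fun t : ℝ => ((-(2 * t * ‖z‖ ^ 2) : ℝ) : EReal)) (𝓝[>] 0)
      (𝓝 ((0 : ℝ) : EReal)) := by
    have hc : Continuous fun t : ℝ => ((-(2 * t * ‖z‖ ^ 2) : ℝ) : EReal) :=
      continuous_coe_real_ereal.comp (by fun_prop)
    simpa using (hc.tendsto 0).mono_left nhdsWithin_le_nhds
  rw [← hlow.limsup_eq]
  have hmap := Filter.limsup_le_limsup_of_le (u := fun p : EuclideanSpace ℝ (Fin r) × ℝ =>
      (((P.g0 (p.1 + p.2 • z) - P.g0 p.1) / p.2 : ℝ) : EReal)) htend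
      (by isBoundedDefault) (by isBoundedDefault)
  refine le_trans ?_ hmap
  refine limsup_le_limsup (v := fun t : ℝ => ((( P.g0 (u - (2 * t) • z + t • z) -
    P.g0 (u - (2 * t) • z)) / t : ℝ) : EReal)) ?_ (by isBoundedDefault) (by isBoundedDefault)
  filter_upwards [self_mem_nhdsWithin] with t ht
  replace ht : 0 < t := ht
  obtain ⟨x', hx'⟩ := P.nonempty_lpArgmin hne hbdd (u - (2 * t) • z + t • z)
  have h1 := P.le_g0_add_smul_sub_div hne hbdd ht hx'
  have h2 := P.inner_image_le_of_mem_lpArgmin hx hx'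
  have h3 : u - (2 * t) • z + t • z - u = (-t) • z := by module
  rw [h3, real_inner_smul_left, hxu, inner_sub_right] at h2
  have h4 : inner ℝ z (P.image x') ≤ inner ℝ z u := by
    by_contra! h
    nlinarith
  rw [inner_sub_left, inner_sub_left, real_inner_smul_left, real_inner_self_eq_norm_sq,
    real_inner_comm, real_inner_comm z (P.image x')] at h1
  refine EReal.coe_le_coe_iff.2 (le_trans ?_ h1)
  linarith

/-- The solutions can be swapped between `u` and `u'`, and monotonicity then reads `-‖u - u'‖² ≥ 0`.
-/
theorem eq_of_lpArgmin_eq {u u' : EuclideanSpace ℝ (Fin r)} {x x' : Fin n → ℝ}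
    (h : P.lpArgmin u = P.lpArgmin u') (hx : x ∈ P.lpArgmin u) (hxu : P.image x = u)
    (hx' : x' ∈ P.lpArgmin u') (hxu' : P.image x' = u') : u = u' := by
  have h1 := P.inner_image_le_of_mem_lpArgmin (h ▸ hx' : x' ∈ P.lpArgmin u) (h ▸ hx)
  rw [hxu, hxu', ← neg_sub u u', inner_neg_left, real_inner_self_eq_norm_sq] at h1
  have h2 : ‖u - u'‖ ^ 2 = 0 := le_antisymm (by linarith) (sq_nonneg _)
  exact sub_eq_zero.1 (norm_eq_zero.1 ((pow_eq_zero_iff two_ne_zero).1 h2))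

theorem finite_clarkeCriticalPoints (hne : P.feasible.Nonempty)
    (hbdd : Bornology.IsBounded P.feasible) : (clarkeCriticalPoints P.g0).Finite := by
  refine Set.Finite.of_injOn (f := fun u => {v | v ∈ P.vertices ∧ u ∈ P.region v})
    (t := 𝒫 P.vertices) (fun u _ v hv => hv.1) ?_ P.finite_vertices.finite_subsets
  intro u hu u' hu' huu'
  have hiff : ∀ v ∈ P.vertices, (u ∈ P.region v ↔ u' ∈ P.region v) := fun v hv =>
    ⟨fun h => ((Set.ext_iff.1 huu' v).1 ⟨hv, h⟩).2, fun h => ((Set.ext_iff.1 huu' v).2 ⟨hv, h⟩).2⟩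
  obtain ⟨x, hx, hxu⟩ := P.exists_image_eq_of_mem_clarkeCriticalPoints hne hbdd hu
  obtain ⟨x', hx', hxu'⟩ := P.exists_image_eq_of_mem_clarkeCriticalPoints hne hbdd hu'
  refine P.eq_of_lpArgmin_eq ?_ hx hxu hx' hxu'
  exact (P.lpArgmin_subset_of_region hne hbdd fun v hv => (hiff v hv).1).antisymm
    (P.lpArgmin_subset_of_region hne hbdd fun v hv => (hiff v hv).2)

end ConcaveQP

/-! ### Counting halvings; finiteness of the uniform bound -/

theorem biSup_lt_top {α : Type*} {s : Set α} (hs : s.Finite) {f : α → ℕ∞}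
    (hf : ∀ a ∈ s, f a < ⊤) : ⨆ a ∈ s, f a < ⊤ := by
  rcases s.eq_empty_or_nonempty with rfl | hne
  · simp
  · rw [← sSup_image, (hs.image f).csSup_lt_iff (hne.image f)]
    exact Set.forall_mem_image.2 hf

theorem exists_numHalvings_eq {η₀ : ℝ} (hη₀ : 0 < η₀) {d : ℝ≥0∞} (hd : d ≠ 0) :
    ∃ k : ℕ, numHalvings η₀ d = k ∧ ENNReal.ofReal (η₀ / 2 ^ k) ≤ d := by
  by_cases hd' : d = ⊤
  · exact ⟨0, by simp [numHalvings, hd'], by simp [hd']⟩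
  · refine ⟨_, by rw [numHalvings, if_neg hd, if_neg hd'], ?_⟩
    have hpos : 0 < d.toReal := ENNReal.toReal_pos hd hd'
    refine ENNReal.ofReal_le_of_le_toReal ?_
    rw [div_le_comm₀ (by positivity) hpos, ← Real.rpow_natCast]
    exact (Real.logb_le_iff_le_rpow one_lt_two (by positivity)).1 (Nat.le_ceil _)

namespace ConcaveQP

variable {m n r : ℕ} (P : ConcaveQP m n r)

theorem uniformBound_lt_top (hne : P.feasible.Nonempty)
    (hbdd : Bornology.IsBounded P.feasible) {η₀ : ℝ} (hη₀ : 0 < η₀) :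
    P.uniformBound η₀ < ⊤ := by
  have hS := P.finite_clarkeCriticalPoints hne hbdd
  have hlt : ∀ {d : ℝ≥0∞}, d ≠ 0 → numHalvings η₀ d < ⊤ := fun hd => by
    obtain ⟨k, hk, -⟩ := exists_numHalvings_eq hη₀ hd
    rw [hk]
    exact ENat.natCast_lt_top k
  refine biSup_lt_top P.finite_vertices fun v _ => max_lt ?_ ?_
  · refine ENat.add_lt_top.2 ⟨?_, by simp⟩
    exact biSup_lt_top (hS.inter_of_left _) fun u hu => hlt (P.zeta_ne_zero hu.2)
  · refine ENat.add_lt_top.2 ⟨?_, ENat.natCast_lt_top 2⟩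
    exact biSup_lt_top (hS.inter_of_left _) fun u hu => hlt (P.lam_ne_zero u)

/-- `v` still solves at `u + t(Bx - Bv)` for small `t > 0`, and monotonicity gives `-t‖Bx - Bv‖² ≥
0`. -/
theorem image_eq_of_mem_interior_region (hne : P.feasible.Nonempty)
    (hbdd : Bornology.IsBounded P.feasible) {v : Fin n → ℝ} (hv : v ∈ P.vertices)
    {u : EuclideanSpace ℝ (Fin r)} (hu : u ∈ interior (P.region v)) {x : Fin n → ℝ}
    (hx : x ∈ P.lpArgmin u) : P.image x = P.image v := by
  have hc : Tendsto (fun t : ℝ => u + t • (P.image x - P.image v)) (𝓝[>] 0) (𝓝 u) := by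
    have : Continuous fun t : ℝ => u + t • (P.image x - P.image v) := by fun_prop
    simpa using (this.tendsto 0).mono_left nhdsWithin_le_nhds
  obtain ⟨t, ht, ht0⟩ := ((hc.eventually (mem_interior_iff_mem_nhds.1 hu)).and
    self_mem_nhdsWithin).exists
  replace ht0 : 0 < t := ht0
  have h := P.inner_image_le_of_mem_lpArgmin hx ((P.mem_region_iff hne hbdd hv).1 ht)
  rw [add_sub_cancel_left, real_inner_smul_left, ← neg_sub (P.image x) (P.image v),
    inner_neg_right, real_inner_self_eq_norm_sq] at h
  have h2 : ‖P.image x - P.image v‖ ^ 2 = 0 := le_antisymm (by nlinarith) (sq_nonneg _)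
  exact sub_eq_zero.1 (norm_eq_zero.1 ((pow_eq_zero_iff two_ne_zero).1 h2))

/-- The factor `½` in `ζ` keeps the closed ball off the frontier, and a connected set meeting the
interior but not the frontier stays in the interior. -/
theorem mem_interior_region_of_edist_le_zeta {v : Fin n → ℝ} {u y : EuclideanSpace ℝ (Fin r)}
    (hu : u ∈ interior (P.region v)) (hy : edist u y ≤ P.zeta v u) :
    y ∈ interior (P.region v) := by
  have hball : Metric.closedBall u (dist u y) ⊆ interior (P.region v) ∪ (P.region v)ᶜ := by
    intro q hq
    by_contra hcon
    rw [Set.mem_union, not_or, Set.notMem_compl_iff] at hcon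
    have hfr : q ∈ frontier (P.region v) := ⟨subset_closure hcon.2, hcon.1⟩
    have h1 : edist u q ≤ Metric.infEDist u (frontier (P.region v)) / 2 := by
      refine le_trans ?_ hy
      rw [edist_dist, edist_dist, dist_comm u q]
      exact ENNReal.ofReal_le_ofReal hq
    have h2 : Metric.infEDist u (frontier (P.region v)) / 2 <
        Metric.infEDist u (frontier (P.region v)) := by
      refine ENNReal.half_lt_self (fun h => P.zeta_ne_zero hu ?_) ?_
      · rw [zeta, h, ENNReal.zero_div]
      · exact ((Metric.infEDist_le_edist_of_mem hfr).trans_lt (edist_lt_top u q)).ne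
    exact (Metric.infEDist_le_edist_of_mem hfr).not_gt (h1.trans_lt h2)
  refine (convex_closedBall u (dist u y)).isPreconnected.subset_left_of_subset_union
    isOpen_interior (P.isClosed_region v).isOpen_compl
    (disjoint_compl_right.mono_left interior_subset) hball
    ⟨u, Metric.mem_closedBall_self dist_nonneg, hu⟩ ?_
  rw [Metric.mem_closedBall, dist_comm]

theorem sub_dotProduct_eq_add_cost (a : ℝ) (u : EuclideanSpace ℝ (Fin r)) (x : Fin n → ℝ) :
    a - (P.B.transpose.mulVec u.ofLp - P.c) ⬝ᵥ x = a + P.cost u x := by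
  rw [cost, ← neg_sub P.c, neg_dotProduct, sub_neg_eq_add]

/-! ### The while loop and its termination -/

section Loop

variable {η₀ : ℝ} {ubar w : EuclideanSpace ℝ (Fin r)}
  {pickPlus pickMinus : ℕ → EuclideanSpace ℝ (Fin r) → (Fin n → ℝ)}

theorem loopState_succ_of_none {k : ℕ}
    (h : (P.loopState η₀ ubar w pickPlus pickMinus k).result = none) :
    P.loopState η₀ ubar w pickPlus pickMinus (k + 1) =
      P.loopBody ubar w (pickPlus k (P.loopState η₀ ubar w pickPlus pickMinus k).uPlus)
        (pickMinus k (P.loopState η₀ ubar w pickPlus pickMinus k).uMinus)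
        (P.loopState η₀ ubar w pickPlus pickMinus k) := by
  rw [loopState]
  simp only [h]

theorem loopState_succ_of_some {k : ℕ} {a : Verdict}
    (h : (P.loopState η₀ ubar w pickPlus pickMinus k).result = some a) :
    P.loopState η₀ ubar w pickPlus pickMinus (k + 1) =
      P.loopState η₀ ubar w pickPlus pickMinus k := by
  rw [loopState]
  simp only [h]

/-- The test `s₊ = s₋ = s` holds exactly when both picks are optimal at `ubar`. -/
theorem loopBody_result (hne : P.feasible.Nonempty) (hbdd : Bornology.IsBounded P.feasible)
    {xPlus xMinus : Fin n → ℝ} (hp : xPlus ∈ P.feasible) (hm : xMinus ∈ P.feasible)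
    (st : LoopState r) :
    ((P.loopBody ubar w xPlus xMinus st).result = some Verdict.localMinimizer ∧
      P.image xPlus = P.image xMinus) ∨
    ((P.loopBody ubar w xPlus xMinus st).result = some Verdict.notLocalMinimizer ∧
      P.image xPlus ≠ P.image xMinus ∧ xPlus ∈ P.lpArgmin ubar ∧ xMinus ∈ P.lpArgmin ubar) ∨
    (P.loopBody ubar w xPlus xMinus st =
      { eta := st.eta / 2, uPlus := ubar + (st.eta / 2) • w, uMinus := ubar - (st.eta / 2) • w,
        result := none } ∧
      P.image xPlus ≠ P.image xMinus ∧ ¬ (xPlus ∈ P.lpArgmin ubar ∧ xMinus ∈ P.lpArgmin ubar)) := by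
  rw [P.mem_lpArgmin_iff hne hbdd hp, P.mem_lpArgmin_iff hne hbdd hm]
  simp only [loopBody, sub_dotProduct_eq_add_cost, add_right_inj]
  split_ifs with h1 h2
  · exact Or.inl ⟨rfl, h1⟩
  · exact Or.inr (Or.inl ⟨rfl, h1, h2⟩)
  · exact Or.inr (Or.inr ⟨rfl, h1, h2⟩)

theorem loopState_of_none (hne : P.feasible.Nonempty) (hbdd : Bornology.IsBounded P.feasible)
    (hp : P.IsPicker pickPlus) (hm : P.IsPicker pickMinus) {k : ℕ}
    (h : (P.loopState η₀ ubar w pickPlus pickMinus k).result = none) :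
    P.loopState η₀ ubar w pickPlus pickMinus k =
      { eta := η₀ / 2 ^ k, uPlus := ubar + (η₀ / 2 ^ k) • w, uMinus := ubar - (η₀ / 2 ^ k) • w,
        result := none } := by
  induction k with
  | zero => simp [loopState]
  | succ k ih =>
    rcases hk : (P.loopState η₀ ubar w pickPlus pickMinus k).result with _ | a
    · rw [P.loopState_succ_of_none hk] at h ⊢
      set st := P.loopState η₀ ubar w pickPlus pickMinus k
      rcases P.loopBody_result hne hbdd (ubar := ubar) (w := w) (hp k st.uPlus).1
        (hm k st.uMinus).1 st with ⟨h', -⟩ | ⟨h', -⟩ | ⟨h', -⟩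
      · simp [h'] at h
      · simp [h'] at h
      · rw [h', ih hk]
        simp only [div_div, pow_succ]
    · rw [P.loopState_succ_of_some hk, hk] at h
      cases h

/-- What a verdict of the loop says about the solutions picked in its last iteration. -/
theorem exists_of_loopState_eq_some (hne : P.feasible.Nonempty)
    (hbdd : Bornology.IsBounded P.feasible)
    (hp : P.IsPicker pickPlus) (hm : P.IsPicker pickMinus) {k : ℕ} {a : Verdict}
    (h : (P.loopState η₀ ubar w pickPlus pickMinus k).result = some a) :
    ∃ j, ∃ xPlus ∈ P.lpArgmin (ubar + (η₀ / 2 ^ j) • w),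
      ∃ xMinus ∈ P.lpArgmin (ubar - (η₀ / 2 ^ j) • w),
      (a = Verdict.localMinimizer ∧ P.image xPlus = P.image xMinus) ∨
      (a = Verdict.notLocalMinimizer ∧ P.image xPlus ≠ P.image xMinus ∧
        xPlus ∈ P.lpArgmin ubar ∧ xMinus ∈ P.lpArgmin ubar) := by
  induction k with
  | zero => simp [loopState] at h
  | succ k ih =>
    rcases hk : (P.loopState η₀ ubar w pickPlus pickMinus k).result with _ | a'
    · rw [P.loopState_succ_of_none hk, P.loopState_of_none hne hbdd hp hm hk] at h
      refine ⟨k, _, hp k _, _, hm k _, ?_⟩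
      rcases P.loopBody_result hne hbdd (ubar := ubar) (w := w) (hp k (ubar + (η₀ / 2 ^ k) • w)).1
        (hm k (ubar - (η₀ / 2 ^ k) • w)).1 _
        with ⟨h', h''⟩ | ⟨h', h''⟩ | ⟨h', -⟩
      · exact Or.inl ⟨Option.some.inj (h.symm.trans h'), h''⟩
      · exact Or.inr ⟨Option.some.inj (h.symm.trans h'), h''⟩
      · rw [h'] at h
        cases h
    · rw [P.loopState_succ_of_some hk] at h
      exact ih h

theorem loopState_succ_ne_none (hne : P.feasible.Nonempty)
    (hbdd : Bornology.IsBounded P.feasible)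
    (hp : P.IsPicker pickPlus) (hm : P.IsPicker pickMinus) {k : ℕ}
    (h : ∀ xPlus ∈ P.lpArgmin (ubar + (η₀ / 2 ^ k) • w),
      ∀ xMinus ∈ P.lpArgmin (ubar - (η₀ / 2 ^ k) • w),
      P.image xPlus = P.image xMinus ∨ (xPlus ∈ P.lpArgmin ubar ∧ xMinus ∈ P.lpArgmin ubar)) :
    ∃ a, (P.loopState η₀ ubar w pickPlus pickMinus (k + 1)).result = some a := by
  rcases hk : (P.loopState η₀ ubar w pickPlus pickMinus k).result with _ | a
  · rw [P.loopState_succ_of_none hk, P.loopState_of_none hne hbdd hp hm hk]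
    rcases P.loopBody_result hne hbdd (ubar := ubar) (w := w) (hp k (ubar + (η₀ / 2 ^ k) • w)).1
      (hm k (ubar - (η₀ / 2 ^ k) • w)).1 _ with ⟨h', -⟩ | ⟨h', -⟩ | ⟨-, h1, h2⟩
    · exact ⟨_, h'⟩
    · exact ⟨_, h'⟩
    · exact ((h _ (hp k _) _ (hm k _)).elim h1 h2).elim
  · exact ⟨a, by rw [P.loopState_succ_of_some hk, hk]⟩

theorem terminatesWithin_of_loopState {xbar : Fin n → ℝ} {k : ℕ} {N : ℕ∞} (hk : (k : ℕ∞) ≤ N)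
    (h : ∃ a, (P.loopState η₀ (P.image xbar) w pickPlus pickMinus k).result = some a) :
    TerminatesWithin (P.certify η₀ xbar w pickPlus pickMinus) N := by
  refine ⟨k, hk, ?_⟩
  rw [certify]
  split_ifs
  · exact ⟨_, rfl⟩
  · exact h

theorem terminatesWithin_of_mem_interior (hne : P.feasible.Nonempty)
    (hbdd : Bornology.IsBounded P.feasible) (hη₀ : 0 < η₀) (hw : ‖w‖ = 1)
    (hp : P.IsPicker pickPlus) (hm : P.IsPicker pickMinus) {xbar v : Fin n → ℝ}
    (hv : v ∈ P.vertices) (hu : P.image xbar ∈ interior (P.region v)) :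
    TerminatesWithin (P.certify η₀ xbar w pickPlus pickMinus)
      (numHalvings η₀ (P.zeta v (P.image xbar)) + 1) := by
  obtain ⟨k, hk, hle⟩ := exists_numHalvings_eq hη₀ (P.zeta_ne_zero hu)
  refine P.terminatesWithin_of_loopState (k := k + 1) (by rw [hk]; norm_cast)
    (P.loopState_succ_ne_none hne hbdd hp hm fun x hx y hy => Or.inl ?_)
  have hη : 0 ≤ η₀ / 2 ^ k := by positivity
  rw [P.image_eq_of_mem_interior_region hne hbdd hv
      (P.mem_interior_region_of_edist_le_zeta hu (hle.trans' ?_)) hx,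
    P.image_eq_of_mem_interior_region hne hbdd hv
      (P.mem_interior_region_of_edist_le_zeta hu (hle.trans' ?_)) hy]
  · rw [edist_dist, dist_self_sub_right, norm_smul, hw, mul_one, Real.norm_of_nonneg hη]
  · rw [edist_dist, dist_self_add_right, norm_smul, hw, mul_one, Real.norm_of_nonneg hη]

theorem terminatesWithin_lam (hne : P.feasible.Nonempty)
    (hbdd : Bornology.IsBounded P.feasible) (hη₀ : 0 < η₀) (hw : ‖w‖ = 1)
    (hp : P.IsPicker pickPlus) (hm : P.IsPicker pickMinus) (xbar : Fin n → ℝ) :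
    TerminatesWithin (P.certify η₀ xbar w pickPlus pickMinus)
      (numHalvings η₀ (P.lam (P.image xbar)) + 2) := by
  obtain ⟨k, hk, hle⟩ := exists_numHalvings_eq hη₀ (P.lam_ne_zero (P.image xbar))
  -- After `k` halvings the step may equal `λ`, where an inactive region can be touched; one more
  -- halving makes it strictly smaller, hence `+ 2`.
  have hη : 0 < η₀ / 2 ^ (k + 1) := by positivity
  have hlt : ENNReal.ofReal (η₀ / 2 ^ (k + 1)) < P.lam (P.image xbar) := by
    refine lt_of_lt_of_le ((ENNReal.ofReal_lt_ofReal_iff (by positivity)).2 ?_) hle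
    exact div_lt_div_of_pos_left hη₀ (by positivity) (pow_lt_pow_right₀ one_lt_two k.lt_succ_self)
  refine P.terminatesWithin_of_loopState (k := k + 1 + 1) (by rw [hk]; norm_cast)
    (P.loopState_succ_ne_none hne hbdd hp hm fun x hx y hy => Or.inr
      ⟨P.lpArgmin_subset_of_edist_lt hne hbdd (hlt.trans_le' ?_) hx,
        P.lpArgmin_subset_of_edist_lt hne hbdd (hlt.trans_le' ?_) hy⟩)
  · rw [edist_dist, dist_self_add_right, norm_smul, hw, mul_one, Real.norm_of_nonneg hη.le]
  · rw [edist_dist, dist_self_sub_right, norm_smul, hw, mul_one, Real.norm_of_nonneg hη.le]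

theorem terminatesWithin_uniformBound (hne : P.feasible.Nonempty)
    (hbdd : Bornology.IsBounded P.feasible) (hη₀ : 0 < η₀) (hw : ‖w‖ = 1)
    (hp : P.IsPicker pickPlus) (hm : P.IsPicker pickMinus) {xbar : Fin n → ℝ}
    (hxbar : xbar ∈ P.feasible) :
    TerminatesWithin (P.certify η₀ xbar w pickPlus pickMinus) (P.uniformBound η₀) := by
  by_cases hcost : P.cost (P.image xbar) xbar > P.lpValue (P.image xbar)
  · exact ⟨0, zero_le, _, if_pos hcost⟩
  have hmin : xbar ∈ P.lpArgmin (P.image xbar) := (P.mem_lpArgmin_iff hne hbdd hxbar).2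
    (le_antisymm (not_lt.1 hcost) (P.lpValue_le hne hbdd hxbar))
  -- A candidate that passes step (a) is critical, so it is among the points over which the bound is
  -- taken.
  have hS := P.mem_clarkeCriticalPoints_of_image_eq hne hbdd hmin rfl
  obtain ⟨v, hv, hvmin⟩ := P.exists_vertex_mem_lpArgmin hne hbdd (P.image xbar)
  have hmem := (P.mem_region_iff hne hbdd hv).2 hvmin
  by_cases hint : P.image xbar ∈ interior (P.region v)
  · obtain ⟨k, hk, h⟩ := P.terminatesWithin_of_mem_interior hne hbdd hη₀ hw hp hm hv hint
    refine ⟨k, hk.trans ?_, h⟩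
    refine le_trans ?_ (le_iSup₂ (f := fun v (_ : v ∈ P.vertices) => max _ _) v hv)
    refine le_trans ?_ (le_max_left _ _)
    gcongr
    exact le_iSup₂ (f := fun u (_ : u ∈ clarkeCriticalPoints P.g0 ∩ interior (P.region v)) =>
      numHalvings η₀ (P.zeta v u)) (P.image xbar) ⟨hS, hint⟩
  · obtain ⟨k, hk, h⟩ := P.terminatesWithin_lam hne hbdd hη₀ hw hp hm xbar
    refine ⟨k, hk.trans ?_, h⟩
    refine le_trans ?_ (le_iSup₂ (f := fun v (_ : v ∈ P.vertices) => max _ _) v hv)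
    refine le_trans ?_ (le_max_right _ _)
    gcongr
    exact le_iSup₂ (f := fun u (_ : u ∈ clarkeCriticalPoints P.g0 ∩ frontier (P.region v)) =>
      numHalvings η₀ (P.lam u)) (P.image xbar) ⟨hS, subset_closure hmem, hint⟩

end Loop

/-! ### Correctness for directions in general position -/

/-- If `B x₊ = B x₋` for solutions at `u ± t w`, then `w` is orthogonal to all differences of
images of solutions at `u`. -/
theorem inner_image_sub_eq_zero {u w : EuclideanSpace ℝ (Fin r)} {t : ℝ} (ht : 0 < t)
    {xPlus xMinus y y' : Fin n → ℝ} (hp : xPlus ∈ P.lpArgmin (u + t • w))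
    (hm : xMinus ∈ P.lpArgmin (u - t • w)) (heq : P.image xPlus = P.image xMinus)
    (hy : y ∈ P.lpArgmin u) (hy' : y' ∈ P.lpArgmin u) :
    inner ℝ w (P.image y - P.image y') = 0 := by
  -- Monotonicity towards `u + tw` and towards `u - tw` bounds `⟪w, Bz⟫` from both sides by the same
  -- number.
  have key : ∀ z ∈ P.lpArgmin u, inner ℝ w (P.image z) = inner ℝ w (P.image xPlus) := by
    intro z hz
    have h1 := P.inner_image_le_of_mem_lpArgmin hz hp
    have h2 := P.inner_image_le_of_mem_lpArgmin hz hm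
    rw [add_sub_cancel_left, real_inner_smul_left, inner_sub_right] at h1
    rw [show u - t • w - u = -(t • w) by abel, inner_neg_left, real_inner_smul_left, ← heq,
      inner_sub_right] at h2
    have h1' := nonneg_of_mul_nonneg_right h1 ht
    have h2' : t * (inner ℝ w (P.image xPlus) - inner ℝ w (P.image z)) ≤ 0 := by linarith
    have h3' := nonpos_of_mul_nonpos_right h2' ht
    linarith
  rw [inner_sub_right, key y hy, key y' hy', sub_self]

theorem isLocalMin_of_image_eq (hne : P.feasible.Nonempty) (hbdd : Bornology.IsBounded P.feasible)
    {xbar : Fin n → ℝ} {w : EuclideanSpace ℝ (Fin r)} {t : ℝ} (ht : 0 < t)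
    (hw : ∀ v ∈ P.vertices, ∀ v' ∈ P.vertices, P.image v ≠ P.image v' →
      inner ℝ w (P.image v - P.image v') ≠ 0)
    (hxbar : xbar ∈ P.lpArgmin (P.image xbar)) {xPlus xMinus : Fin n → ℝ}
    (hp : xPlus ∈ P.lpArgmin (P.image xbar + t • w))
    (hm : xMinus ∈ P.lpArgmin (P.image xbar - t • w)) (heq : P.image xPlus = P.image xMinus) :
    IsLocalMin P.g0 (P.image xbar) := by
  obtain ⟨v, hv, hvmin⟩ := P.exists_vertex_mem_lpArgmin hne hbdd (P.image xbar)
  have hsub : P.lpArgmin (P.image xbar) ⊆ P.imageLinear ⁻¹' {P.image v} := by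
    refine (P.lpArgmin_subset_convexHull hbdd _).trans
      (convexHull_min ?_ ((convex_singleton _).linear_preimage _))
    intro v' hv'
    by_contra hcon
    exact hw v' hv'.1 v hv hcon (P.inner_image_sub_eq_zero ht hp hm heq hv'.2 hvmin)
  rw [P.isLocalMin_g0_iff hne hbdd]
  exact fun x hx => (hsub hx).trans (hsub hxbar).symm

/-- This justifies the rejection in step (a). A solution `x` at `B xbar` has `Bx = B xbar`, so the
costs of `x` and `xbar` differ by the same amount at every `u`, and optimality at `uε` transfers. -/
theorem mem_lpArgmin_image_of_isLocalMin (hne : P.feasible.Nonempty)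
    (hbdd : Bornology.IsBounded P.feasible) {uε : EuclideanSpace ℝ (Fin r)} {xbar : Fin n → ℝ}
    (hxbar : xbar ∈ P.lpArgmin uε) (h : IsLocalMin P.g0 (P.image xbar)) :
    xbar ∈ P.lpArgmin (P.image xbar) := by
  obtain ⟨x, hx⟩ := P.nonempty_lpArgmin hne hbdd (P.image xbar)
  have hxi := (P.isLocalMin_g0_iff hne hbdd _).1 h x hx
  refine ⟨hxbar.1, fun y hy => le_trans ?_ (hx.2 y hy)⟩
  have h1 := hxbar.2 x hx.1
  rw [cost_eq, cost_eq, hxi] at h1 ⊢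
  linarith

end ConcaveQP

/-- The cone over the exceptional directions lies in the proper subspace orthogonal to `d`, which is
Haar-null. -/
theorem ae_toSphere_inner_ne_zero {E : Type*} [NormedAddCommGroup E] [InnerProductSpace ℝ E]
    [FiniteDimensional ℝ E] [MeasurableSpace E] [BorelSpace E] (μ : Measure E)
    [μ.IsAddHaarMeasure] {d : E} (hd : d ≠ 0) :
    ∀ᵐ w : Metric.sphere (0 : E) 1 ∂μ.toSphere, inner ℝ (w : E) d ≠ 0 := by
  rw [ae_iff]
  have hmeas : MeasurableSet {w : Metric.sphere (0 : E) 1 | ¬ inner ℝ (w : E) d ≠ 0} := by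
    simp only [not_not]
    exact (isClosed_eq (by fun_prop) continuous_const).measurableSet
  rw [Measure.toSphere_apply' _ hmeas]
  refine mul_eq_zero_of_right _ (measure_mono_null ?_
    (Measure.addHaar_submodule μ (LinearMap.ker (innerₗ E d)) fun h => hd ?_))
  · rintro _ ⟨t, -, _, ⟨w, hw, rfl⟩, rfl⟩
    have hw' : inner ℝ (w : E) d = 0 := not_not.1 hw
    change innerₗ E d (t • (w : E)) = 0
    rw [innerₗ_apply_apply, real_inner_smul_right, real_inner_comm, hw', mul_zero]
  · have : d ∈ LinearMap.ker (innerₗ E d) := h ▸ Submodule.mem_top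
    exact (inner_self_eq_zero (𝕜 := ℝ)).1 this

namespace ConcaveQP

variable {m n r : ℕ} (P : ConcaveQP m n r)

theorem ae_uniformSphere_inner_image_ne_zero :
    ∀ᵐ w : Metric.sphere (0 : EuclideanSpace ℝ (Fin r)) 1 ∂(uniformSphere r),
      ∀ v ∈ P.vertices, ∀ v' ∈ P.vertices, P.image v ≠ P.image v' →
        inner ℝ (w : EuclideanSpace ℝ (Fin r)) (P.image v - P.image v') ≠ 0 := by
  have hc := P.finite_vertices.countable
  refine (ae_ball_iff hc).2 fun v _ => (ae_ball_iff hc).2 fun v' _ => ?_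
  by_cases h : P.image v = P.image v'
  · simp [h]
  · exact (Measure.ae_smul_measure (ae_toSphere_inner_ne_zero volume (sub_ne_zero.2 h)) _).mono
      fun w hw _ => hw

/-- For a direction `w` in general position, every verdict is correct. -/
theorem certify_sound (hne : P.feasible.Nonempty) (hbdd : Bornology.IsBounded P.feasible)
    {η₀ : ℝ} (hη₀ : 0 < η₀) {uε w : EuclideanSpace ℝ (Fin r)} {xbar : Fin n → ℝ}
    (hxbar : xbar ∈ P.lpArgmin uε)
    (hw : ∀ v ∈ P.vertices, ∀ v' ∈ P.vertices, P.image v ≠ P.image v' →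
      inner ℝ w (P.image v - P.image v') ≠ 0)
    {pickPlus pickMinus : ℕ → EuclideanSpace ℝ (Fin r) → (Fin n → ℝ)}
    (hp : P.IsPicker pickPlus) (hm : P.IsPicker pickMinus) {k : ℕ} {a : Verdict}
    (h : P.certify η₀ xbar w pickPlus pickMinus k = some a) :
    (a = Verdict.localMinimizer ∧ IsLocalMin P.g0 (P.image xbar)) ∨
      (a = Verdict.notLocalMinimizer ∧ ¬ IsLocalMin P.g0 (P.image xbar)) := by
  rw [certify] at h
  split_ifs at h with hcost
  · refine Or.inr ⟨(Option.some.inj h).symm, fun hmin => ?_⟩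
    exact hcost.ne (P.lpValue_eq (P.mem_lpArgmin_image_of_isLocalMin hne hbdd hxbar hmin))
  · have hmin : xbar ∈ P.lpArgmin (P.image xbar) := (P.mem_lpArgmin_iff hne hbdd hxbar.1).2
      (le_antisymm (not_lt.1 hcost) (P.lpValue_le hne hbdd hxbar.1))
    obtain ⟨j, x, hx, y, hy, ⟨ha, heq⟩ | ⟨ha, hneq, hx', hy'⟩⟩ :=
      P.exists_of_loopState_eq_some hne hbdd hp hm h
    · exact Or.inl ⟨ha, P.isLocalMin_of_image_eq hne hbdd (by positivity) hw hmin hx hy heq⟩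
    · refine Or.inr ⟨ha, fun hloc => hneq ?_⟩
      rw [P.isLocalMin_g0_iff hne hbdd] at hloc
      rw [hloc x hx', hloc y hy']

end ConcaveQP

theorem proposition4 {m n r : ℕ} (hr : 0 < r) (P : ConcaveQP m n r)
    (hne : P.feasible.Nonempty) (hbdd : Bornology.IsBounded P.feasible)
    (η₀ : ℝ) (hη₀ : 0 < η₀) :
    (clarkeCriticalPoints P.g0).Finite ∧
    P.uniformBound η₀ < ⊤ ∧
    ∀ (uε : EuclideanSpace ℝ (Fin r)) (xbar : Fin n → ℝ), xbar ∈ P.lpArgmin uε →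
      (∀ᵐ w : Metric.sphere (0 : EuclideanSpace ℝ (Fin r)) 1 ∂(uniformSphere r),
        ∀ pickPlus pickMinus : ℕ → EuclideanSpace ℝ (Fin r) → (Fin n → ℝ),
          P.IsPicker pickPlus → P.IsPicker pickMinus →
          (Returns (P.certify η₀ xbar w pickPlus pickMinus) Verdict.localMinimizer ↔
            IsLocalMin P.g0 (P.image xbar)) ∧
          (Returns (P.certify η₀ xbar w pickPlus pickMinus) Verdict.notLocalMinimizer ↔
            ¬ IsLocalMin P.g0 (P.image xbar))) ∧
      (∀ w : Metric.sphere (0 : EuclideanSpace ℝ (Fin r)) 1,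
        ∀ pickPlus pickMinus : ℕ → EuclideanSpace ℝ (Fin r) → (Fin n → ℝ),
          P.IsPicker pickPlus → P.IsPicker pickMinus →
          (∀ v ∈ P.vertices, P.image xbar ∈ interior (P.region v) →
            TerminatesWithin (P.certify η₀ xbar w pickPlus pickMinus)
              (numHalvings η₀ (P.zeta v (P.image xbar)) + 1)) ∧
          (∀ v ∈ P.vertices, P.image xbar ∈ frontier (P.region v) →
            TerminatesWithin (P.certify η₀ xbar w pickPlus pickMinus)
              (numHalvings η₀ (P.lam (P.image xbar)) + 2)) ∧
          TerminatesWithin (P.certify η₀ xbar w pickPlus pickMinus) (P.uniformBound η₀)) := by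
  refine ⟨P.finite_clarkeCriticalPoints hne hbdd, P.uniformBound_lt_top hne hbdd hη₀,
    fun uε xbar hxbar => ⟨?_, fun w pickPlus pickMinus hp hm => ?_⟩⟩
  -- The exceptional null set depends only on the vertices, so it serves all pickers at once.
  · filter_upwards [P.ae_uniformSphere_inner_image_ne_zero] with w hw pickPlus pickMinus hp hm
    have hsound : ∀ {a}, Returns (P.certify η₀ xbar w pickPlus pickMinus) a →
        (a = Verdict.localMinimizer ∧ IsLocalMin P.g0 (P.image xbar)) ∨
          (a = Verdict.notLocalMinimizer ∧ ¬ IsLocalMin P.g0 (P.image xbar)) :=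
      fun ⟨_, h⟩ => P.certify_sound hne hbdd hη₀ hxbar hw hp hm h
    obtain ⟨k, -, a, ha⟩ := P.terminatesWithin_lam hne hbdd hη₀ (norm_eq_of_mem_sphere w) hp hm xbar
    have hret : Returns (P.certify η₀ xbar w pickPlus pickMinus) a := ⟨k, ha⟩
    refine ⟨⟨fun h => ?_, fun h => ?_⟩, ⟨fun h => ?_, fun h => ?_⟩⟩
    · exact (hsound h).elim And.right fun h' => nomatch h'.1
    · exact (hsound hret).elim (fun h' => h'.1 ▸ hret) fun h' => (h'.2 h).elim
    · exact (hsound h).elim (fun h' => nomatch h'.1) And.right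
    · exact (hsound hret).elim (fun h' => (h h'.2).elim) fun h' => h'.1 ▸ hret
  · have hw := norm_eq_of_mem_sphere w
    exact ⟨fun v hv hu => P.terminatesWithin_of_mem_interior hne hbdd hη₀ hw hp hm hv hu,
      fun v _ _ => P.terminatesWithin_lam hne hbdd hη₀ hw hp hm xbar,
      P.terminatesWithin_uniformBound hne hbdd hη₀ hw hp hm hxbar.1⟩
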